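/- **Fair load station.** Let $W\ge 1$ be an integer, $\lambda,T,\sigma>0$ and $r\in[0,1]$. A station is described by a discrete-time Markov chain $(K,N)$, where $N\ge 0$ is the number of its packets and $K\in\{0,\dots,W\}$ its back-off counter ($K=0$ if $N=0$). Successive slots are independent: a slot is full (length $T$) with probability $r$ and a mini-slot (length $\sigma$) with probability $1-r$. During a slot of length $d$, a Poisson($\lambda d$) number of new packets arrives, independently of the past and added at the end of the slot. - If $K>0$, the counter is unchanged in a full slot and decreases by $1$ in a mini-slot. - If $K=0$, the station transmits (removes) one packet in a full slot if it has one, and transmits nothing in a mini-slot; in both cases, if packets are present after the slot, a new counter is drawn uniformly in $\{0,\dots,W\}$. **Fair broadcast network.** A tagged station sees $M\ge 1$ other identical stations. The network is called ergodic if there is an $r\in[0,1]$ such that the chain above is ergodic (irreducible, aperiodic and positive recurrent) and its stationary distribution $q$ satisfies $$r = 1-(1-\bar\tau)^M,\qquad \bar\tau=\sum_{n\ge1}q(0,n).$$ **Theorem.** Let $M,W\ge 1$ be integers. The equation $2u^{M+1}=W(1-u)$ has a unique root $u$ in $[0,1]$, and $u(2+W)-W>0$. For all $T,\sigma>0$,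 put $$\bar\lambda_{\max}=\frac{1-u}{T+\dfrac{W\sigma(1-u)}{u(2+W)-W}} .$$ Then, for every $\lambda>0$, the fair broadcast network is ergodic if and only if $\lambda<\bar\lambda_{\max}$. In particular $\bar\lambda_{\max}$ is the maximum achievable throughput, i.e. the least upper bound of the $\lambda>0$ for which the network is ergodic. -/

import Mathlib

open scoped ENNReal

noncomputable section

/-! ### Discrete-time Markov chains on a discrete state space

A time-homogeneous chain on `S` is given by its transition law `P : S → PMF S`. -/

namespace MarkovChain

variable {S : Type*}

/-- Law of the chain after `n` steps, started at `x`. -/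
def nStep (P : S → PMF S) : ℕ → S → PMF S
  | 0, x => PMF.pure x
  | n + 1, x => (P x).bind (nStep P n)

/-- Every state can be reached from every state. -/
def Irreducible (P : S → PMF S) : Prop :=
  ∀ x y, ∃ n, 0 < nStep P n x y

/-- For every state, the greatest common divisor of its possible return times is `1`. -/
def Aperiodic (P : S → PMF S) : Prop :=
  ∀ x, ∀ d : ℕ, (∀ n, 1 ≤ n → 0 < nStep P n x x → d ∣ n) → d = 1

open Classical in
/-- `firstPassage P y n x` is the probability that the chain started at `x` visits `y`, at a time
`≥ 1`, for the first time exactly at time `n + 1`. -/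
def firstPassage (P : S → PMF S) (y : S) : ℕ → S → ℝ≥0∞
  | 0, x => P x y
  | n + 1, x => ∑' z, if z = y then 0 else P x z * firstPassage P y n z

/-- Every state is almost surely revisited, and its mean return time is finite. -/
def PositiveRecurrent (P : S → PMF S) : Prop :=
  ∀ x, ∑' n, firstPassage P x n x = 1 ∧
    ∑' n : ℕ, ((n : ℝ≥0∞) + 1) * firstPassage P x n x < ⊤

/-- Ergodic chain: irreducible, aperiodic and positive recurrent. -/
structure Ergodic (P : S → PMF S) : Prop where
  irreducible : Irreducible P
  aperiodic : Aperiodic P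
  positiveRecurrent : PositiveRecurrent P

/-- `q` is a stationary distribution of the chain. -/
def Stationary (P : S → PMF S) (q : PMF S) : Prop :=
  q.bind P = q

end MarkovChain

/-! ### The fair load station -/

namespace FairLoad

/-- State `(k, n)` of a station: back-off counter `k ∈ {0, …, W}` and number `n` of packets, the
counter being `0` when the station has no packet. -/
@[ext]
structure State (W : ℕ) where
  counter : Fin (W + 1)
  packets : ℕ
  counter_eq_zero : packets = 0 → counter = 0

/-- The state with `n` packets and counter `k`, if `n ≥ 1`, and the idle state if `n = 0`. -/
def State.of {W : ℕ} (k : Fin (W + 1)) (n : ℕ) : State W where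
  counter := if n = 0 then 0 else k
  packets := n
  counter_eq_zero := fun h => if_pos h

/-- The current slot is full (`true`) with probability `r`, a mini-slot otherwise. -/
def slot (r : unitInterval) : PMF Bool :=
  (ProbabilityTheory.bernoulliMeasure true false r).toPMF

/-- Number of packets arriving during a slot of duration `d`: Poisson with mean `lam * d`. -/
def arrivals (lam d : ℝ) : PMF ℕ :=
  (ProbabilityTheory.poissonMeasure (lam * d).toNNReal).toPMF

/-- With `n` packets present, choose a new counter uniformly in `{0, …, W}` (no counter is needed
if `n = 0`). -/
def drawBackoff (W n : ℕ) : PMF (State W) :=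
  (PMF.uniformOfFintype (Fin (W + 1))).map fun k => State.of k n

/-- One slot of the fair load station. The slot is full (duration `T`) with probability `r` and a
mini-slot (duration `σ`) otherwise, and `a` packets arrive meanwhile.
* Counter `0`: in a full slot the station transmits one packet, if it has one; in a mini-slot it
  transmits nothing. In both cases a new counter is drawn for the next pending packet, if any.
* Positive counter: it is unchanged in a full slot and decreased by `1` in a mini-slot. -/
def step (W : ℕ) (lam T σ : ℝ) (r : unitInterval) (s : State W) : PMF (State W) :=
  (slot r).bind fun full =>
    (arrivals lam (if full then T else σ)).bind fun a =>
      if s.counter = 0 then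
        drawBackoff W (if full then s.packets - 1 + a else s.packets + a)
      else
        PMF.pure (State.of (if full then s.counter else s.counter - 1) (s.packets + a))

/-- `∑_{n ≥ 1} q(0, n)`: the probability that a station distributed according to `q` has a pending
packet and a counter equal to `0`. -/
def transmitProb {W : ℕ} (q : PMF (State W)) : ℝ :=
  (∑' n : ℕ, q (State.of 0 (n + 1))).toReal

/-- The fair broadcast network: a tagged station sees `M` other identical stations, so that a slot
is full with probability `r = 1 - (1 - τ)^M`, where `τ = ∑_{n ≥ 1} q(0, n)` is computed from the
stationary distribution `q` of the station itself. The network is ergodic if there is such an `r`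
for which the station is ergodic. -/
def NetworkErgodic (M W : ℕ) (lam T σ : ℝ) : Prop :=
  ∃ (r : unitInterval) (q : PMF (State W)),
    MarkovChain.Ergodic (step W lam T σ r) ∧
    MarkovChain.Stationary (step W lam T σ r) q ∧
    (r : ℝ) = 1 - (1 - transmitProb q) ^ M

/-- The formula for the maximum throughput, in terms of `u`. -/
def lamMax (W : ℕ) (T σ u : ℝ) : ℝ :=
  (1 - u) / (T + W * σ * (1 - u) / (u * (2 + W) - W))

end FairLoad

end

namespace MarkovChain

variable {S : Type*}

/-! In the stationary regime two balances hold. Conservation of packets (`departure_rate`) gives `r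
τ = λ (r T + (1 - r) σ)`, and the mean back-off drift (`counter_balance`) gives `(1 - r) (1 - e - τ)
= (W / 2) τ`, where `e` is the mass of the idle state. With `v = 1 - τ` and `r = 1 - v ^ M`, the
first says `λ = rate M T σ v`, and the second, since `e > 0` for an ergodic chain, says `W (1 - v) <
2 v ^ (M + 1)`, that is `u < v`. As `rate` is strictly decreasing, `λ < rate M T σ u`, which is
`lamMax`.

Conversely, if `λ < rate M T σ u`, some `v` in `(u, 1)` has `rate M T σ v = λ`. For `r = 1 - v ^ M`
the inequality `u < v` is the drift condition for a Lyapunov function linear in the packets and the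
counter (`exists_stationary_step`), so a stationary law exists. Irreducibility makes it positive
everywhere, and Kac's inequality yields positive recurrence. Packet conservation then forces `τ = 1
- v`, so the fixed-point relation for `r` holds automatically. -/

theorem tsum_bind_mul {A B : Type*} (p : PMF A) (f : A → PMF B) (F : B → ℝ≥0∞) :
    ∑' y, p.bind f y * F y = ∑' x, p x * ∑' y, f x y * F y := by
  simp_rw [PMF.bind_apply, ← ENNReal.tsum_mul_right, ← ENNReal.tsum_mul_left, mul_assoc]
  exact ENNReal.tsum_comm

theorem tsum_pure_mul {A : Type*} (a : A) (F : A → ℝ≥0∞) :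
    ∑' y, PMF.pure a y * F y = F a := by
  rw [tsum_eq_single a (fun b hb => by simp [PMF.pure_apply_of_ne _ _ hb])]
  simp

theorem tsum_map_mul {A B : Type*} (p : PMF A) (f : A → B) (F : B → ℝ≥0∞) :
    ∑' y, p.map f y * F y = ∑' x, p x * F (f x) := by
  rw [PMF.map, tsum_bind_mul]
  simp

/-! ### Existence of a stationary distribution -/

open Classical in
/-- `taboo P o n y` is the probability that the chain started at `o` is at `y` at time `n`, without
having returned to `o` at any of the times `1, …, n`. -/
noncomputable def taboo (P : S → PMF S) (o : S) : ℕ → S → ℝ≥0∞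
  | 0, y => if y = o then 1 else 0
  | n + 1, y => if y = o then 0 else ∑' x, taboo P o n x * P x y

open Classical in
/-- A Foster drift condition outside a single state yields a stationary distribution. -/
theorem exists_stationary_of_drift (P : S → PMF S) (o : S) (V : S → ℝ≥0∞) (ho : V o ≠ ⊤)
    (hV : ∀ x, (∑' y, P x y * (if y = o then 0 else V y)) + 1 ≤ V x) :
    ∃ q, Stationary P q := by
  -- Each step of an excursion from `o` costs at least its surviving mass in mean `V`; summed over
  -- time, this bounds the mean excursion length by `V o`.
  have hstep : ∀ n, (∑' y, taboo P o (n + 1) y * V y) + ∑' x, taboo P o n x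
      ≤ ∑' x, taboo P o n x * V x := by
    intro n
    have h1 : ∑' y, taboo P o (n + 1) y * V y
        = ∑' x, taboo P o n x * ∑' y, P x y * (if y = o then 0 else V y) := by
      simp_rw [← ENNReal.tsum_mul_left]
      rw [ENNReal.tsum_comm]
      refine tsum_congr fun y => ?_
      by_cases hy : y = o
      · simp [taboo, hy]
      · simp [taboo, hy, ← ENNReal.tsum_mul_right, mul_assoc]
    rw [h1, ← ENNReal.tsum_add]
    refine ENNReal.tsum_le_tsum fun x => ?_
    calc _ = taboo P o n x * ((∑' y, P x y * (if y = o then 0 else V y)) + 1) := by ring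
      _ ≤ _ := by gcongr; exact hV x
  have hsum : ∀ n, (∑' y, taboo P o n y * V y) + ∑ i ∈ Finset.range n, ∑' x, taboo P o i x
      ≤ V o := by
    intro n
    induction n with
    | zero =>
      simp only [Finset.range_zero, Finset.sum_empty, add_zero]
      rw [tsum_eq_single o (fun b hb => by simp [taboo, hb])]
      simp [taboo]
    | succ n ih =>
      rw [Finset.sum_range_succ]
      calc _ = ((∑' y, taboo P o (n + 1) y * V y) + ∑' x, taboo P o n x)
            + ∑ i ∈ Finset.range n, ∑' x, taboo P o i x := by ring
        _ ≤ _ := (add_le_add_left (hstep n) _).trans ih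
  -- The invariant measure is the mean number of visits during one excursion from `o`.
  set μ : S → ℝ≥0∞ := fun x => ∑' n, taboo P o n x with hμ
  have htot : ∑' x, μ x ≠ ⊤ := by
    have : ∑' x, μ x ≤ V o := by
      rw [hμ, ENNReal.tsum_comm]
      exact ENNReal.tsum_le_of_sum_range_le fun n => le_trans le_add_self (hsum n)
    exact ne_top_of_le_ne_top ho this
  have hμo : μ o = 1 := by
    simp only [hμ]
    rw [tsum_eq_zero_add' ENNReal.summable]
    simp [taboo]
  have hbal : ∀ y, y ≠ o → ∑' x, μ x * P x y = μ y := by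
    intro y hy
    simp only [hμ]
    rw [tsum_eq_zero_add' (f := fun n => taboo P o n y) ENNReal.summable]
    simp_rw [← ENNReal.tsum_mul_right]
    rw [ENNReal.tsum_comm]
    simp [taboo, hy]
  have hmass : ∑' y, ∑' x, μ x * P x y = ∑' x, μ x := by
    rw [ENNReal.tsum_comm]
    simp [ENNReal.tsum_mul_left]
  -- Off `o`, invariance is built into `taboo`. At `o` it follows because `P` preserves the total
  -- mass, which is finite and can be cancelled.
  have hbalo : ∑' x, μ x * P x o = μ o := by
    rw [ENNReal.tsum_eq_add_tsum_ite o, ENNReal.tsum_eq_add_tsum_ite (f := μ) o] at hmass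
    have h2 : ∑' y, (if y = o then 0 else ∑' x, μ x * P x y)
        = ∑' y, (if y = o then 0 else μ y) := by
      refine tsum_congr fun y => ?_
      split_ifs with h
      · rfl
      · exact hbal y h
    rw [h2] at hmass
    refine (ENNReal.add_left_inj ?_).1 hmass
    refine ne_top_of_le_ne_top htot (ENNReal.tsum_le_tsum fun y => ?_)
    split_ifs <;> simp
  have h0 : ∑' x, μ x ≠ 0 := by
    intro h
    have := ENNReal.tsum_eq_zero.1 h o
    simp [hμo] at this
  refine ⟨PMF.normalize μ h0 htot, ?_⟩
  refine PMF.ext fun y => ?_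
  simp_rw [PMF.bind_apply, PMF.normalize_apply, mul_right_comm _ (∑' x, μ x)⁻¹,
    ENNReal.tsum_mul_right]
  congr 1
  by_cases hy : y = o
  · rw [hy, hbalo]
  · exact hbal y hy

/-! ### Positive recurrence from a stationary distribution -/

open Classical in
/-- Probability that the chain started at `x` does not visit `y` at the times `1, …, n`. -/
noncomputable def survival (P : S → PMF S) (y : S) : ℕ → S → ℝ≥0∞
  | 0, _ => 1
  | n + 1, x => ∑' z, if z = y then 0 else P x z * survival P y n z

/-- A path avoiding `y` at times `1, …, n` either hits it at time `n + 1` or survives once more;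
`firstPassage` at index `n` refers to time `n + 1`. -/
theorem firstPassage_add_survival (P : S → PMF S) (y : S) (n : ℕ) (x : S) :
    firstPassage P y n x + survival P y (n + 1) x = survival P y n x := by
  classical
  induction n generalizing x with
  | zero =>
    simp only [firstPassage, survival, mul_one]
    rw [← (P x).tsum_coe, ENNReal.tsum_eq_add_tsum_ite (f := P x) y]
  | succ n ih =>
    rw [firstPassage, survival, survival, ← ENNReal.tsum_add]
    refine tsum_congr fun z => ?_
    split_ifs
    · simp
    · rw [← mul_add, ih]

theorem sum_firstPassage_add_survival (P : S → PMF S) (y x : S) (n : ℕ) :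
    ∑ i ∈ Finset.range n, firstPassage P y i x + survival P y n x = 1 := by
  induction n with
  | zero => simp [survival]
  | succ n ih => rw [Finset.sum_range_succ, add_assoc, firstPassage_add_survival, ih]

/-- Summation by parts: the truncated form of the formula expressing a mean as the sum of its tails.
-/
theorem sum_mul_firstPassage_add_survival (P : S → PMF S) (y x : S) (n : ℕ) :
    ∑ i ∈ Finset.range n, ((i : ℝ≥0∞) + 1) * firstPassage P y i x + n * survival P y n x
      = ∑ i ∈ Finset.range n, survival P y i x := by
  induction n with
  | zero => simp
  | succ n ih =>
    rw [Finset.sum_range_succ, Finset.sum_range_succ, ← ih,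
      ← firstPassage_add_survival P y n x]
    push_cast
    ring

theorem Stationary.tsum_mul {P : S → PMF S} {q : PMF S} (hq : Stationary P q) (F : S → ℝ≥0∞) :
    ∑' x, q x * ∑' y, P x y * F y = ∑' x, q x * F x := by
  rw [← tsum_bind_mul, hq]

/-- One half of Kac's formula: the mean return time to `y` is at most `1 / q y`. -/
theorem Stationary.tsum_survival_le {P : S → PMF S} {q : PMF S} (hq : Stationary P q) (y : S) :
    q y * ∑' n, survival P y n y ≤ 1 := by
  classical
  set a : ℕ → ℝ≥0∞ := fun n => ∑' z, q z * (if z = y then 0 else survival P y n z) with ha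
  -- Under `q`, `a n` is the probability of avoiding `y` at times `0, …, n`. By stationarity the
  -- window shifts to `1, …, n + 1`; splitting on whether the chain starts at `y` makes the sum
  -- telescope.
  have key : ∀ n, q y * survival P y (n + 1) y + a (n + 1) = a n := by
    intro n
    have h1 : a n = ∑' z, q z * survival P y (n + 1) z := by
      simp only [ha]
      rw [← hq.tsum_mul]
      refine tsum_congr fun x => ?_
      rw [survival]
      congr 1
      refine tsum_congr fun z => ?_
      split_ifs <;> simp
    rw [h1, ENNReal.tsum_eq_add_tsum_ite y]
    congr 1
    refine tsum_congr fun z => ?_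
    split_ifs <;> simp
  have h0 : q y + a 0 = 1 := by
    rw [← q.tsum_coe, ENNReal.tsum_eq_add_tsum_ite y]
    congr 1
    refine tsum_congr fun z => ?_
    split_ifs <;> simp [survival]
  have hn : ∀ n, ∑ i ∈ Finset.range (n + 1), q y * survival P y i y + a n = 1 := by
    intro n
    induction n with
    | zero => simpa [survival] using h0
    | succ n ih => rw [Finset.sum_range_succ, add_assoc, key, ih]
  rw [← ENNReal.tsum_mul_left]
  refine ENNReal.tsum_le_of_sum_range_le fun n => ?_
  refine le_trans ?_ (hn n).le
  rw [Finset.sum_range_succ, add_assoc]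
  exact le_self_add

theorem Stationary.positiveRecurrent {P : S → PMF S} {q : PMF S} (hq : Stationary P q)
    (hpos : ∀ x, 0 < q x) : PositiveRecurrent P := by
  intro x
  have hfin : ∑' n, survival P x n x ≠ ⊤ := by
    intro h
    have := hq.tsum_survival_le x
    rw [h, ENNReal.mul_top (hpos x).ne'] at this
    simp at this
  constructor
  · have h1 := ENNReal.tendsto_nat_tsum (fun n => firstPassage P x n x)
    have h2 := ENNReal.tendsto_atTop_zero_of_tsum_ne_top hfin
    have h3 := h1.add h2
    simp_rw [sum_firstPassage_add_survival, add_zero] at h3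
    exact tendsto_nhds_unique h3 tendsto_const_nhds
  · refine lt_of_le_of_lt (ENNReal.tsum_le_of_sum_range_le fun n => ?_) hfin.lt_top
    calc _ ≤ ∑ i ∈ Finset.range n, survival P x i x := by
          rw [← sum_mul_firstPassage_add_survival]; exact le_self_add
      _ ≤ _ := ENNReal.sum_le_tsum _

theorem Stationary.nStep {P : S → PMF S} {q : PMF S} (hq : Stationary P q) (n : ℕ) :
    q.bind (nStep P n) = q := by
  induction n with
  | zero => exact PMF.bind_pure q
  | succ n ih =>
    have : q.bind (MarkovChain.nStep P (n + 1)) = (q.bind P).bind (MarkovChain.nStep P n) := by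
      rw [PMF.bind_bind]; rfl
    rw [this, hq, ih]

theorem Stationary.pos {P : S → PMF S} {q : PMF S} (hq : Stationary P q) (hP : Irreducible P)
    (y : S) : 0 < q y := by
  obtain ⟨x, hx⟩ := q.support_nonempty
  obtain ⟨n, hn⟩ := hP x y
  rw [← hq.nStep n, PMF.apply_pos_iff, PMF.mem_support_bind_iff]
  exact ⟨x, hx, (PMF.apply_pos_iff _ _).1 hn⟩

/-! ### Irreducibility and aperiodicity -/

theorem exists_nStep_pos_of_reflTransGen {P : S → PMF S} {x y : S}
    (h : Relation.ReflTransGen (fun s t => 0 < P s t) x y) : ∃ n, 0 < nStep P n x y := by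
  induction h using Relation.ReflTransGen.head_induction_on with
  | refl => exact ⟨0, by simp [nStep]⟩
  | head h _ ih =>
    obtain ⟨n, hn⟩ := ih
    refine ⟨n + 1, ?_⟩
    rw [nStep, PMF.apply_pos_iff, PMF.mem_support_bind_iff]
    exact ⟨_, (PMF.apply_pos_iff _ _).1 h, (PMF.apply_pos_iff _ _).1 hn⟩

theorem nStep_add (P : S → PMF S) (m n : ℕ) (x : S) :
    nStep P (m + n) x = (nStep P m x).bind (nStep P n) := by
  induction m generalizing x with
  | zero => simp [nStep]
  | succ m ih =>
    rw [Nat.add_right_comm, nStep, nStep, PMF.bind_bind]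
    congr 1
    funext z
    exact ih z

theorem nStep_add_pos {P : S → PMF S} {m n : ℕ} {x y z : S} (h1 : 0 < nStep P m x y)
    (h2 : 0 < nStep P n y z) : 0 < nStep P (m + n) x z := by
  rw [nStep_add, PMF.apply_pos_iff, PMF.mem_support_bind_iff]
  exact ⟨y, (PMF.apply_pos_iff _ _).1 h1, (PMF.apply_pos_iff _ _).1 h2⟩

/-- A path from `x` through `o` and back can take the loop at `o` once or twice, giving two
consecutive return times. -/
theorem Irreducible.aperiodic {P : S → PMF S} (hP : Irreducible P) {o : S} (ho : 0 < P o o) :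
    Aperiodic P := by
  intro x d hd
  obtain ⟨m, hm⟩ := hP x o
  obtain ⟨n, hn⟩ := hP o x
  have h1 : 0 < nStep P 1 o o := by
    rw [nStep, PMF.apply_pos_iff, PMF.mem_support_bind_iff]
    exact ⟨o, (PMF.apply_pos_iff _ _).1 ho, by simp [nStep]⟩
  have ha := hd (m + 1 + n) (by omega) (nStep_add_pos (nStep_add_pos hm h1) hn)
  have hb := hd (m + 1 + 1 + n) (by omega)
    (nStep_add_pos (nStep_add_pos (nStep_add_pos hm h1) h1) hn)
  have := (Nat.dvd_sub hb ha)
  rw [show m + 1 + 1 + n - (m + 1 + n) = 1 by omega] at this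
  exact Nat.dvd_one.1 this

/-! ### Balance equations of a stationary distribution -/

/-- The drift of `F` is `h - g`, and its stationary mean vanishes. Gains and losses stay on opposite
sides to avoid subtraction in `ℝ≥0∞`; the finite mean of `F` permits cancellation. -/
theorem Stationary.tsum_mul_eq_of_drift {P : S → PMF S} {q : PMF S} (hq : Stationary P q)
    {F g h : S → ℝ≥0∞} (hF : ∑' x, q x * F x ≠ ⊤)
    (hd : ∀ x, ∑' y, P x y * F y + g x = F x + h x) :
    ∑' x, q x * g x = ∑' x, q x * h x := by
  have : ∑' x, q x * F x + ∑' x, q x * g x = ∑' x, q x * F x + ∑' x, q x * h x := by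
    conv_lhs => rw [← hq.tsum_mul F]
    rw [← ENNReal.tsum_add, ← ENNReal.tsum_add]
    refine tsum_congr fun x => ?_
    rw [← mul_add, ← mul_add, hd]
  exact (ENNReal.add_right_inj hF).1 this

theorem natCast_sub_eq_tsum (a b : ℕ) :
    ((a - b : ℕ) : ℝ≥0∞) = ∑' m, if b ≤ m ∧ m < a then 1 else 0 := by
  have : ∀ m, (if b ≤ m ∧ m < a then (1 : ℝ≥0∞) else 0) = if m ∈ Finset.Ico b a then 1 else 0 := by
    simp
  simp_rw [this]
  rw [tsum_eq_sum (s := Finset.Ico b a) (by intro m hm; simp only [hm, if_false]),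
    Finset.sum_ite_mem, Finset.inter_self]
  simp

/-- In the stationary regime, the mean upward and downward displacements of an integer valued
functional agree. -/
theorem Stationary.tsum_sub_eq_tsum_sub {P : S → PMF S} {q : PMF S} (hq : Stationary P q)
    (f : S → ℕ) :
    ∑' x, q x * ∑' y, P x y * ((f y - f x : ℕ) : ℝ≥0∞)
      = ∑' x, q x * ∑' y, P x y * ((f x - f y : ℕ) : ℝ≥0∞) := by
  -- `f` may have infinite mean, so a displacement is counted as the number of levels `m` it
  -- crosses. Upward and downward crossings balance at each level, since the indicator of `m < f` is
  -- bounded.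
  simp_rw [natCast_sub_eq_tsum, ← ENNReal.tsum_mul_left]
  have hcomm : ∀ H : S → S → ℕ → ℝ≥0∞, ∑' x, ∑' y, ∑' m, H x y m = ∑' m, ∑' x, ∑' y, H x y m := by
    intro H
    rw [ENNReal.tsum_comm]
    rw [ENNReal.tsum_comm]
    simp_rw [fun x => ENNReal.tsum_comm (f := fun y m => H x y m)]
    rw [ENNReal.tsum_comm]
  rw [hcomm, hcomm]
  refine tsum_congr fun m => ?_
  simp_rw [ENNReal.tsum_mul_left]
  refine (hq.tsum_mul_eq_of_drift (F := fun x => if m < f x then 1 else 0)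
    (g := fun x => ∑' y, P x y * if f y ≤ m ∧ m < f x then 1 else 0)
    (h := fun x => ∑' y, P x y * if f x ≤ m ∧ m < f y then 1 else 0) ?_ ?_).symm
  · refine ne_top_of_le_ne_top ENNReal.one_ne_top ?_
    rw [← q.tsum_coe]
    refine ENNReal.tsum_le_tsum fun x => ?_
    split_ifs <;> simp
  · intro x
    rw [← ENNReal.tsum_add]
    by_cases hx : m < f x
    · simp only [hx, and_true, if_true, not_le.2 hx, false_and, if_false, mul_zero, tsum_zero,
        add_zero]
      rw [← (P x).tsum_coe]
      refine tsum_congr fun y => ?_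
      by_cases hy : m < f y
      · simp [hy, not_le.2 hy]
      · simp [hy, not_lt.1 hy]
    · simp [hx, not_lt.1 hx]

end MarkovChain

namespace FairLoad

open MarkovChain

/-! ### Slots, arrivals and back-off draws -/

theorem slot_true (r : unitInterval) : slot r true = ENNReal.ofReal r := by
  rw [slot, MeasureTheory.Measure.toPMF_apply,
    ProbabilityTheory.bernoulliMeasure_apply_of_mem_of_notMem _ (by simp) (by simp) (by simp)]
  rw [ENNReal.ofReal, unitInterval.toNNReal]
  congr 1
  exact (Real.toNNReal_of_nonneg r.2.1).symm

theorem slot_false (r : unitInterval) : slot r false = ENNReal.ofReal (1 - r) := by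
  rw [slot, MeasureTheory.Measure.toPMF_apply,
    ProbabilityTheory.bernoulliMeasure_apply_of_notMem_of_mem _ (by simp) (by simp) (by simp)]
  rw [ENNReal.ofReal, unitInterval.toNNReal]
  congr 1
  exact (Real.toNNReal_of_nonneg (unitInterval.symm r).2.1).symm

theorem tsum_slot_mul (r : unitInterval) (F : Bool → ℝ≥0∞) :
    ∑' b, slot r b * F b = ENNReal.ofReal r * F true + ENNReal.ofReal (1 - r) * F false := by
  rw [tsum_bool, slot_true, slot_false, add_comm]

section arrivals

variable {lam d : ℝ}

theorem arrivals_apply (h : 0 ≤ lam * d) (a : ℕ) :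
    arrivals lam d a
      = ENNReal.ofReal (Real.exp (-(lam * d)) * (lam * d) ^ a / a.factorial) := by
  rw [arrivals, MeasureTheory.Measure.toPMF_apply, ProbabilityTheory.poissonMeasure_singleton,
    Real.coe_toNNReal _ h]

theorem arrivals_pos (h : 0 < lam * d) (a : ℕ) : 0 < arrivals lam d a := by
  rw [arrivals_apply h.le, ENNReal.ofReal_pos]
  positivity

theorem tsum_arrivals_mul_natCast (h : 0 ≤ lam * d) :
    ∑' a, arrivals lam d a * (a : ℝ≥0∞) = ENNReal.ofReal (lam * d) := by
  rw [tsum_eq_zero_add' ENNReal.summable]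
  have : ∀ a : ℕ, arrivals lam d (a + 1) * ((a + 1 : ℕ) : ℝ≥0∞)
      = arrivals lam d a * ENNReal.ofReal (lam * d) := by
    intro a
    rw [arrivals_apply h, arrivals_apply h, ← ENNReal.ofReal_natCast,
      ← ENNReal.ofReal_mul (by positivity), ← ENNReal.ofReal_mul (by positivity)]
    congr 1
    rw [Nat.factorial_succ]
    push_cast
    field_simp
    ring
  simp_rw [this, ENNReal.tsum_mul_right]
  simp

theorem tsum_arrivals_mul_ofReal (h : 0 ≤ lam * d) {x y : ℝ} (hx : 0 ≤ x) (hy : 0 ≤ y) :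
    ∑' a, arrivals lam d a * ENNReal.ofReal (x + y * a) = ENNReal.ofReal (x + y * (lam * d)) := by
  have : ∀ a : ℕ, arrivals lam d a * ENNReal.ofReal (x + y * a)
      = arrivals lam d a * ENNReal.ofReal x
        + arrivals lam d a * (a : ℝ≥0∞) * ENNReal.ofReal y := by
    intro a
    rw [ENNReal.ofReal_add hx (by positivity), ENNReal.ofReal_mul hy, ENNReal.ofReal_natCast]
    ring
  simp_rw [this]
  rw [ENNReal.tsum_add, ENNReal.tsum_mul_right, ENNReal.tsum_mul_right,
    tsum_arrivals_mul_natCast h, PMF.tsum_coe, one_mul, ENNReal.ofReal_add hx (by positivity),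
    ENNReal.ofReal_mul hy, mul_comm (ENNReal.ofReal y)]

/-- Truncated subtraction differs from `a - 1` only at `a = 0`, which accounts for the term
`arrivals lam d 0`. -/
theorem tsum_arrivals_mul_pred (h : 0 ≤ lam * d) :
    ∑' a, arrivals lam d a * ((a - 1 : ℕ) : ℝ≥0∞) + 1
      = ENNReal.ofReal (lam * d) + arrivals lam d 0 := by
  conv_lhs => rw [← (arrivals lam d).tsum_coe]
  rw [← tsum_arrivals_mul_natCast h, tsum_eq_zero_add' ENNReal.summable,
    tsum_eq_zero_add' (f := fun a => arrivals lam d a * (a : ℝ≥0∞)) ENNReal.summable,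
    tsum_eq_zero_add' (f := arrivals lam d) ENNReal.summable]
  simp only [Nat.zero_sub, Nat.cast_zero, mul_zero, zero_add, Nat.add_sub_cancel]
  rw [add_left_comm, ← ENNReal.tsum_add, add_comm]
  congr 1
  refine tsum_congr fun a => ?_
  push_cast
  ring

end arrivals

theorem State.of_self {W : ℕ} (s : State W) : State.of s.counter s.packets = s := by
  ext
  · by_cases h : s.packets = 0
    · simp [State.of, h, s.counter_eq_zero h]
    · simp [State.of, h]
  · rfl

theorem State.packets_of {W : ℕ} (k : Fin (W + 1)) (n : ℕ) : (State.of k n).packets = n := rfl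

theorem State.counter_of {W : ℕ} (k : Fin (W + 1)) {n : ℕ} (hn : n ≠ 0) :
    (State.of k n).counter = k := by simp [State.of, hn]

theorem State.of_zero {W : ℕ} (k : Fin (W + 1)) : State.of k 0 = State.of 0 0 := by
  ext <;> simp [State.of]

theorem State.packets_ne_zero {W : ℕ} {s : State W} (hs : s.counter ≠ 0) : s.packets ≠ 0 :=
  fun h => hs (s.counter_eq_zero h)

theorem State.eq_of_zero_zero_iff {W : ℕ} {s : State W} : s = State.of 0 0 ↔ s.packets = 0 := by
  refine ⟨fun h => by rw [h]; rfl, fun h => ?_⟩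
  rw [← s.of_self, h, State.of_zero]

theorem tsum_drawBackoff_mul (W n : ℕ) (F : State W → ℝ≥0∞) :
    ∑' s, drawBackoff W n s * F s = ∑' k, PMF.uniformOfFintype (Fin (W + 1)) k * F (State.of k n) :=
  tsum_map_mul _ _ _

theorem tsum_uniform_mul_ofReal (W : ℕ) {x y : ℝ} (hx : 0 ≤ x) (hy : 0 ≤ y) :
    ∑' k : Fin (W + 1), PMF.uniformOfFintype (Fin (W + 1)) k * ENNReal.ofReal (x + y * k)
      = ENNReal.ofReal (x + y * W / 2) := by
  simp_rw [PMF.uniformOfFintype_apply, ENNReal.tsum_mul_left]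
  rw [tsum_fintype, ← ENNReal.ofReal_sum_of_nonneg (fun i _ => by positivity), Fintype.card_fin,
    ← ENNReal.ofReal_natCast, ← ENNReal.ofReal_inv_of_pos (by positivity),
    ← ENNReal.ofReal_mul (by positivity)]
  congr 1
  have h : ∑ i : Fin (W + 1), (i : ℝ) = W * (W + 1) / 2 := by
    rw [Fin.sum_univ_eq_sum_range (fun i => (i : ℝ)) (W + 1)]
    induction W with
    | zero => simp
    | succ n ih => rw [Finset.sum_range_succ, ih]; push_cast; ring
  rw [Finset.sum_add_distrib, ← Finset.mul_sum, h]
  simp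
  field_simp

theorem tsum_drawBackoff_mul_of_const (W n : ℕ) {F : State W → ℝ≥0∞} {c : ℝ≥0∞}
    (hF : ∀ k, F (State.of k n) = c) : ∑' s, drawBackoff W n s * F s = c := by
  rw [tsum_drawBackoff_mul]
  simp_rw [hF, ENNReal.tsum_mul_right, PMF.tsum_coe, one_mul]

theorem tsum_drawBackoff_mul_packets (W n : ℕ) (f : ℕ → ℝ≥0∞) :
    ∑' s, drawBackoff W n s * f s.packets = f n :=
  tsum_drawBackoff_mul_of_const W n (F := fun s => f s.packets) fun _ => rfl

theorem drawBackoff_pos {W : ℕ} (k : Fin (W + 1)) (n : ℕ) : 0 < drawBackoff W n (State.of k n) := by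
  rw [drawBackoff, PMF.apply_pos_iff, PMF.mem_support_map_iff]
  exact ⟨k, by simp, rfl⟩

/-! ### One slot of the station -/

section step

variable {W : ℕ} {lam T σ : ℝ} {r : unitInterval} {s : State W}

theorem tsum_step_mul_of_counter_eq_zero (hs : s.counter = 0) (F : State W → ℝ≥0∞) :
    ∑' t, step W lam T σ r s t * F t
      = ENNReal.ofReal r * ∑' a, arrivals lam T a *
          ∑' t, drawBackoff W (s.packets - 1 + a) t * F t
        + ENNReal.ofReal (1 - r) * ∑' a, arrivals lam σ a *
          ∑' t, drawBackoff W (s.packets + a) t * F t := by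
  simp only [step, tsum_bind_mul, tsum_slot_mul, hs, if_true, Bool.false_eq_true, if_false]

theorem tsum_step_mul_of_counter_ne_zero (hs : s.counter ≠ 0) (F : State W → ℝ≥0∞) :
    ∑' t, step W lam T σ r s t * F t
      = ENNReal.ofReal r * ∑' a, arrivals lam T a * F (State.of s.counter (s.packets + a))
        + ENNReal.ofReal (1 - r) * ∑' a, arrivals lam σ a *
          F (State.of (s.counter - 1) (s.packets + a)) := by
  simp only [step, tsum_bind_mul, tsum_slot_mul, hs, if_true, Bool.false_eq_true, if_false,
    tsum_pure_mul]

theorem ofReal_mul_add_ofReal_mul (r : unitInterval) {x y : ℝ} (hx : 0 ≤ x) (hy : 0 ≤ y) :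
    ENNReal.ofReal r * ENNReal.ofReal x + ENNReal.ofReal (1 - r) * ENNReal.ofReal y
      = ENNReal.ofReal (r * x + (1 - r) * y) := by
  have h0 := r.2.1
  have h1 : (0 : ℝ) ≤ 1 - r := sub_nonneg.2 r.2.2
  rw [← ENNReal.ofReal_mul h0, ← ENNReal.ofReal_mul h1, ← ENNReal.ofReal_add] <;> positivity

theorem ofReal_add_ofReal_one_sub (r : unitInterval) :
    ENNReal.ofReal r + ENNReal.ofReal (1 - r) = 1 := by
  rw [← ENNReal.ofReal_add r.2.1 (sub_nonneg.2 r.2.2)]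
  simp

theorem natCast_counter_sub_one (hs : s.counter ≠ 0) :
    (((s.counter - 1 : Fin (W + 1)) : ℕ) : ℝ) = (s.counter : ℕ) - 1 := by
  rw [Fin.val_sub_one_of_ne_zero hs, Nat.cast_sub]
  · simp
  · exact Nat.one_le_iff_ne_zero.2 (fun h => hs (Fin.ext h))

/-! ### Irreducibility -/

theorem slot_pos (hr0 : 0 < (r : ℝ)) (hr1 : (r : ℝ) < 1) (b : Bool) : 0 < slot r b := by
  cases b
  · rw [slot_false]; simpa using hr1
  · rw [slot_true]; simpa using hr0

theorem step_pos_of_counter_eq_zero (hl : 0 < lam) (hT : 0 < T) (hσ : 0 < σ)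
    (hr0 : 0 < (r : ℝ)) (hr1 : (r : ℝ) < 1) (hs : s.counter = 0) (full : Bool) (a : ℕ)
    (k : Fin (W + 1)) :
    0 < step W lam T σ r s
      (State.of k (if full then s.packets - 1 + a else s.packets + a)) := by
  rw [step, PMF.apply_pos_iff, PMF.mem_support_bind_iff]
  refine ⟨full, (PMF.apply_pos_iff _ _).1 (slot_pos hr0 hr1 full), ?_⟩
  rw [PMF.mem_support_bind_iff]
  refine ⟨a, (PMF.apply_pos_iff _ _).1 (arrivals_pos (mul_pos hl ?_) a), ?_⟩
  · split_ifs <;> assumption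
  · rw [if_pos hs]
    exact (PMF.apply_pos_iff _ _).1 (drawBackoff_pos _ _)

theorem step_pos_of_counter_ne_zero (hl : 0 < lam) (hσ : 0 < σ)
    (hr0 : 0 < (r : ℝ)) (hr1 : (r : ℝ) < 1) (hs : s.counter ≠ 0) :
    0 < step W lam T σ r s (State.of (s.counter - 1) s.packets) := by
  rw [step, PMF.apply_pos_iff, PMF.mem_support_bind_iff]
  refine ⟨false, (PMF.apply_pos_iff _ _).1 (slot_pos hr0 hr1 false), ?_⟩
  rw [PMF.mem_support_bind_iff]
  refine ⟨0, (PMF.apply_pos_iff _ _).1 (arrivals_pos (mul_pos hl ?_) 0), ?_⟩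
  · simpa using hσ
  · simp [hs]

/-- Every path goes through the idle state: empty mini-slots run the counter down, then full slots
without arrivals, each drawing counter `0`, clear the queue. From idle, a single mini-slot with the
right arrivals and draw reaches any state. -/
theorem irreducible_step (hl : 0 < lam) (hT : 0 < T) (hσ : 0 < σ)
    (hr0 : 0 < (r : ℝ)) (hr1 : (r : ℝ) < 1) : Irreducible (step W lam T σ r) := by
  have h1 : ∀ (k : ℕ) (s : State W), (s.counter : ℕ) = k →
      Relation.ReflTransGen (fun s t => 0 < step W lam T σ r s t) s (State.of 0 s.packets) := by
    intro k
    induction k with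
    | zero =>
      intro s hs
      have : s.counter = 0 := Fin.ext hs
      conv_lhs => rw [← s.of_self, this]
    | succ k ih =>
      intro s hs
      have hc : s.counter ≠ 0 := fun h => by simp [h] at hs
      refine .head (step_pos_of_counter_ne_zero hl hσ hr0 hr1 hc)
        (ih (State.of (s.counter - 1) s.packets) ?_)
      rw [State.counter_of _ (State.packets_ne_zero hc), Fin.val_sub_one_of_ne_zero hc, hs]
      rfl
  have h2 : ∀ n : ℕ, Relation.ReflTransGen (fun s t => 0 < step W lam T σ r s t)
      (State.of 0 n) (State.of 0 0) := by
    intro n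
    induction n with
    | zero => exact .refl
    | succ n ih =>
      refine .head ?_ ih
      exact step_pos_of_counter_eq_zero hl hT hσ hr0 hr1 (by simp [State.of]) true 0 0
  intro s t
  refine exists_nStep_pos_of_reflTransGen (((h1 _ s rfl).trans (h2 _)).tail ?_)
  have := step_pos_of_counter_eq_zero (s := State.of 0 0) hl hT hσ hr0 hr1 (by simp [State.of])
    false t.packets t.counter
  simpa [State.packets_of, State.of_self] using this

theorem aperiodic_step (hl : 0 < lam) (hT : 0 < T) (hσ : 0 < σ)
    (hr0 : 0 < (r : ℝ)) (hr1 : (r : ℝ) < 1) : Aperiodic (step W lam T σ r) :=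
  (irreducible_step hl hT hσ hr0 hr1).aperiodic (o := State.of 0 0)
    (step_pos_of_counter_eq_zero hl hT hσ hr0 hr1 (by simp [State.of]) true 0 0)

/-! ### Drift -/

/-- The Lyapunov function `(n + b k) / ε`. -/
noncomputable def lyapunov (b ε : ℝ) (s : State W) : ℝ≥0∞ :=
  ENNReal.ofReal ((s.packets + b * (s.counter : ℕ)) / ε)

/-- Only an inequality, because `State.of` discards the counter when `n = 0`. -/
theorem lyapunov_of_le {b ε : ℝ} (hb : 0 ≤ b) (hε : 0 < ε) (k : Fin (W + 1)) (n : ℕ) :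
    lyapunov b ε (State.of k n) ≤ ENNReal.ofReal (n / ε + b / ε * (k : ℕ)) := by
  rw [lyapunov]
  refine ENNReal.ofReal_le_ofReal ?_
  rw [add_div, mul_div_right_comm, State.packets_of]
  gcongr
  simp only [State.of]
  split_ifs <;> simp

theorem tsum_drawBackoff_mul_lyapunov_le {b ε : ℝ} (hb : 0 ≤ b) (hε : 0 < ε) (n : ℕ) :
    ∑' s, drawBackoff W n s * lyapunov b ε s ≤ ENNReal.ofReal (n / ε + b / ε * W / 2) := by
  rw [tsum_drawBackoff_mul, ← tsum_uniform_mul_ofReal W (by positivity) (by positivity)]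
  refine ENNReal.tsum_le_tsum fun k => ?_
  gcongr
  exact lyapunov_of_le hb hε k n

theorem tsum_step_mul_lyapunov_le_of_counter_eq_zero {b ε : ℝ} (hb : 0 ≤ b) (hε : 0 < ε)
    (hl : 0 < lam) (hT : 0 < T) (hσ : 0 < σ) (hs : s.counter = 0) :
    ∑' t, step W lam T σ r s t * lyapunov b ε t
      ≤ ENNReal.ofReal ((r * ((s.packets - 1 : ℕ) + lam * T)
          + (1 - r) * (s.packets + lam * σ) + b * W / 2) / ε) := by
  have h : ∀ (d : ℝ) (_ : 0 < d) (n : ℕ), ∑' a, arrivals lam d a *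
      ∑' t, drawBackoff W (n + a) t * lyapunov b ε t
      ≤ ENNReal.ofReal ((n + b * W / 2 + lam * d) / ε) := by
    intro d hd n
    have e : (n + b * W / 2 + lam * d) / ε = (n + b * W / 2) / ε + 1 / ε * (lam * d) := by
      field_simp
    rw [e, ← tsum_arrivals_mul_ofReal (by positivity) (by positivity) (by positivity)]
    refine ENNReal.tsum_le_tsum fun a => ?_
    gcongr
    refine (tsum_drawBackoff_mul_lyapunov_le hb hε _).trans_eq ?_
    congr 1
    push_cast
    field_simp
    ring
  rw [tsum_step_mul_of_counter_eq_zero hs]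
  refine (add_le_add (mul_le_mul_right (h T hT _) _) (mul_le_mul_right (h σ hσ _) _)).trans_eq ?_
  rw [ofReal_mul_add_ofReal_mul r (by positivity) (by positivity)]
  congr 1
  field_simp
  ring

theorem tsum_step_mul_lyapunov_of_counter_ne_zero {b ε : ℝ} (hb : 0 ≤ b) (hε : 0 < ε)
    (hl : 0 < lam) (hT : 0 < T) (hσ : 0 < σ) (hs : s.counter ≠ 0) :
    ∑' t, step W lam T σ r s t * lyapunov b ε t
      = ENNReal.ofReal ((s.packets + b * (s.counter : ℕ) + lam * (r * T + (1 - r) * σ)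
          - (1 - r) * b) / ε) := by
  have h : ∀ (d : ℝ) (_ : 0 < d) (k : Fin (W + 1)), ∑' a, arrivals lam d a *
      lyapunov b ε (State.of k (s.packets + a))
      = ENNReal.ofReal ((s.packets + b * (k : ℕ) + lam * d) / ε) := by
    intro d hd k
    have e : (s.packets + b * (k : ℕ) + lam * d) / ε
        = (s.packets + b * (k : ℕ)) / ε + 1 / ε * (lam * d) := by
      field_simp
    rw [e, ← tsum_arrivals_mul_ofReal (by positivity) (by positivity) (by positivity)]
    refine tsum_congr fun a => ?_
    have := State.packets_ne_zero hs
    rw [lyapunov, State.counter_of _ (by omega), State.packets_of]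
    congr 2
    push_cast
    field_simp
    ring
  rw [tsum_step_mul_of_counter_ne_zero hs, h T hT, h σ hσ,
    ofReal_mul_add_ofReal_mul r (by positivity) (by positivity), natCast_counter_sub_one hs]
  congr 1
  field_simp
  ring

theorem exists_stationary_step (hl : 0 < lam) (hT : 0 < T) (hσ : 0 < σ)
    (hr0 : 0 < (r : ℝ)) (hr1 : (r : ℝ) < 1)
    (hstab : lam * (r * T + (1 - r) * σ) * (2 * (1 - r) + W) < r * (2 * (1 - r))) :
    ∃ q, Stationary (step W lam T σ r) q := by
  classical
  have h1 : 0 < 1 - (r : ℝ) := sub_pos.2 hr1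
  set D : ℝ := 2 * (1 - r) + W with hD
  have hDpos : 0 < D := by positivity
  set A : ℝ := lam * (r * T + (1 - r) * σ) with hA
  -- `b` and `ε` solve the two linear equations `e1` and `e2`, which make the drift of `n + b k`
  -- equal to `-ε` both at positive counter and at counter `0` with a pending packet. The hypothesis
  -- `hstab` is exactly `ε > 0`.
  set ε : ℝ := r * (2 * (1 - r)) / D - A with hε
  have hεpos : 0 < ε := by rw [hε, sub_pos, lt_div_iff₀ hDpos]; exact hstab
  set b : ℝ := 2 * r / D with hb
  have hbpos : 0 < b := by positivity
  have e1 : A + ε = (1 - r) * b := by rw [hε, hb]; field_simp; ring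
  have e2 : A + ε + b * W / 2 = r := by
    rw [hε, hb]; field_simp; rw [hD]; ring
  clear_value b ε A D
  -- The drift condition ignores the value of `V` at the arrival state `o`, so at the idle state `V`
  -- may be any finite number that is large enough.
  refine exists_stationary_of_drift _ (State.of 0 0)
    (fun s => if s = State.of 0 0 then
      ∑' t, step W lam T σ r (State.of 0 0) t * lyapunov b ε t + 1 else lyapunov b ε s) ?_ ?_
  · simp only [if_true]
    refine ENNReal.add_ne_top.2 ⟨?_, ENNReal.one_ne_top⟩
    exact ne_top_of_le_ne_top ENNReal.ofReal_ne_top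
      (tsum_step_mul_lyapunov_le_of_counter_eq_zero hbpos.le hεpos hl hT hσ (by simp [State.of]))
  · intro s
    have hle : (∑' t, step W lam T σ r s t * (if t = State.of 0 0 then 0 else
        if t = State.of 0 0 then
          ∑' t, step W lam T σ r (State.of 0 0) t * lyapunov b ε t + 1 else lyapunov b ε t)) + 1
        ≤ ∑' t, step W lam T σ r s t * lyapunov b ε t + 1 := by
      gcongr with t
      split_ifs <;> simp
    refine hle.trans ?_
    split_ifs with hs
    · rw [hs]
    have hp : s.packets ≠ 0 := fun h => hs (State.eq_of_zero_zero_iff.2 h)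
    by_cases hc : s.counter = 0
    · refine (add_le_add_left (tsum_step_mul_lyapunov_le_of_counter_eq_zero hbpos.le hεpos
        hl hT hσ hc) 1).trans_eq ?_
      rw [← ENNReal.ofReal_one, ← ENNReal.ofReal_add (by positivity) zero_le_one, lyapunov, hc]
      congr 1
      rw [Nat.cast_sub (Nat.one_le_iff_ne_zero.2 hp)]
      field_simp
      simp
      linear_combination 2 * e2 - 2 * hA
    · rw [tsum_step_mul_lyapunov_of_counter_ne_zero hbpos.le hεpos hl hT hσ hc,
        ← ENNReal.ofReal_one, ← ENNReal.ofReal_add ?_ zero_le_one, lyapunov]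
      · refine ENNReal.ofReal_le_ofReal (le_of_eq ?_)
        field_simp
        linear_combination e1 - hA
      · have hk : (1 : ℝ) ≤ (s.counter : ℕ) := by
          exact_mod_cast Nat.one_le_iff_ne_zero.2 (fun h => hc (Fin.ext h))
        have hA0 : 0 ≤ A := by rw [hA]; positivity
        have : (1 - r) * b ≤ b * (s.counter : ℕ) := by nlinarith
        rw [← hA]
        refine div_nonneg ?_ hεpos.le
        have : (0 : ℝ) ≤ s.packets := by positivity
        linarith

/-! ### Balance equations -/

variable {q : PMF (State W)}

open Classical in
theorem transmitProb_eq (q : PMF (State W)) :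
    ∑' n : ℕ, q (State.of 0 (n + 1))
      = ∑' s, q s * (if s.counter = 0 ∧ s.packets ≠ 0 then 1 else 0) := by
  have hinj : Function.Injective (fun n : ℕ => (State.of 0 (n + 1) : State W)) := by
    intro m n h
    simpa [State.of] using h
  rw [← hinj.tsum_eq (f := fun s => q s * (if s.counter = 0 ∧ s.packets ≠ 0 then 1 else 0))]
  · simp [State.of]
  · intro s hs
    have h : s.counter = 0 ∧ s.packets ≠ 0 := by
      by_contra h
      simp [h] at hs
    refine ⟨s.packets - 1, ?_⟩
    simp only
    rw [Nat.sub_add_cancel (Nat.one_le_iff_ne_zero.2 h.2)]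
    conv_rhs => rw [← s.of_self, h.1]

theorem tsum_transmit_ne_top (q : PMF (State W)) : ∑' n : ℕ, q (State.of 0 (n + 1)) ≠ ⊤ := by
  classical
  rw [transmitProb_eq]
  refine ne_top_of_le_ne_top ENNReal.one_ne_top ?_
  rw [← q.tsum_coe]
  refine ENNReal.tsum_le_tsum fun x => ?_
  split_ifs <;> simp

theorem transmitProb_nonneg (q : PMF (State W)) : 0 ≤ transmitProb q := ENNReal.toReal_nonneg

theorem ofReal_transmitProb (q : PMF (State W)) :
    ENNReal.ofReal (transmitProb q) = ∑' n : ℕ, q (State.of 0 (n + 1)) :=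
  ENNReal.ofReal_toReal (tsum_transmit_ne_top q)

-- The queue shrinks only when a packet is transmitted in a full slot with no arrival, and then by
-- one.
open Classical in
theorem tsum_step_mul_packets_decrease :
    ∑' t, step W lam T σ r s t * ((s.packets - t.packets : ℕ) : ℝ≥0∞)
      = ENNReal.ofReal r * arrivals lam T 0 *
        (if s.counter = 0 ∧ s.packets ≠ 0 then 1 else 0) := by
  by_cases hc : s.counter = 0
  · rw [tsum_step_mul_of_counter_eq_zero hc]
    simp_rw [tsum_drawBackoff_mul_packets W _ (fun m => ((s.packets - m : ℕ) : ℝ≥0∞))]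
    rw [tsum_eq_single 0]
    · by_cases hp : s.packets = 0
      · simp [hp]
      · have : s.packets - (s.packets - 1) = 1 := by omega
        simp [hc, hp, this]
    · intro a ha
      rw [show s.packets - (s.packets - 1 + a) = 0 by omega]
      simp
  · rw [tsum_step_mul_of_counter_ne_zero hc]
    simp [State.packets_of, hc]

-- Net change is arrivals minus transmissions. The last term compensates for transmissions without
-- arrivals, which are decreases and do not enter the positive part.
open Classical in
theorem tsum_step_mul_packets_increase (hl : 0 < lam) (hT : 0 < T) (hσ : 0 < σ) :
    ∑' t, step W lam T σ r s t * ((t.packets - s.packets : ℕ) : ℝ≥0∞)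
        + ENNReal.ofReal r * (if s.counter = 0 ∧ s.packets ≠ 0 then 1 else 0)
      = ENNReal.ofReal (lam * (r * T + (1 - r) * σ)) + ENNReal.ofReal r * arrivals lam T 0 *
        (if s.counter = 0 ∧ s.packets ≠ 0 then 1 else 0) := by
  have hA : ENNReal.ofReal (lam * (r * T + (1 - r) * σ))
      = ENNReal.ofReal r * ENNReal.ofReal (lam * T)
        + ENNReal.ofReal (1 - r) * ENNReal.ofReal (lam * σ) := by
    rw [ofReal_mul_add_ofReal_mul r (by positivity) (by positivity)]
    congr 1
    ring
  have hmT := tsum_arrivals_mul_natCast (lam := lam) (d := T) (by positivity)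
  have hmσ := tsum_arrivals_mul_natCast (lam := lam) (d := σ) (by positivity)
  by_cases hc : s.counter = 0
  · rw [tsum_step_mul_of_counter_eq_zero hc]
    simp_rw [tsum_drawBackoff_mul_packets W _ (fun m => ((m - s.packets : ℕ) : ℝ≥0∞))]
    by_cases hp : s.packets = 0
    · simp [hp, hA, hmT, hmσ]
    · have h1 : ∀ a, s.packets - 1 + a - s.packets = a - 1 := by omega
      simp only [h1, Nat.add_sub_cancel_left, hmσ, hc, hp, ne_eq, not_false_eq_true, and_self,
        if_true, mul_one]
      rw [hA, add_right_comm, add_right_comm _ _ (ENNReal.ofReal r * _), ← mul_add,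
        ← tsum_arrivals_mul_pred (by positivity)]
      ring
  · rw [tsum_step_mul_of_counter_ne_zero hc]
    simp [State.packets_of, hc, hA, hmT, hmσ]

/-- Conservation of packets: the departure rate is the arrival rate. -/
theorem departure_rate (hl : 0 < lam) (hT : 0 < T) (hσ : 0 < σ)
    (hq : Stationary (step W lam T σ r) q) :
    r * transmitProb q = lam * (r * T + (1 - r) * σ) := by
  classical
  have h1 := hq.tsum_sub_eq_tsum_sub State.packets
  simp_rw [tsum_step_mul_packets_decrease] at h1
  have h2 : ∑' s, q s * ∑' t, step W lam T σ r s t * ((t.packets - s.packets : ℕ) : ℝ≥0∞)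
        + ∑' s, q s * (ENNReal.ofReal r * (if s.counter = 0 ∧ s.packets ≠ 0 then 1 else 0))
      = ∑' s, q s * ENNReal.ofReal (lam * (r * T + (1 - r) * σ))
        + ∑' s, q s * (ENNReal.ofReal r * arrivals lam T 0 *
          (if s.counter = 0 ∧ s.packets ≠ 0 then 1 else 0)) := by
    rw [← ENNReal.tsum_add, ← ENNReal.tsum_add]
    refine tsum_congr fun s => ?_
    rw [← mul_add, ← mul_add, tsum_step_mul_packets_increase hl hT hσ]
  -- The mean decrease now appears on both sides; it is finite and cancels.
  rw [h1, add_comm] at h2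
  simp_rw [mul_left_comm (q _)] at h2
  rw [ENNReal.tsum_mul_left, ENNReal.tsum_mul_left, ENNReal.tsum_mul_right, ← transmitProb_eq,
    PMF.tsum_coe, one_mul, ← ofReal_transmitProb] at h2
  rw [ENNReal.add_left_inj, ← ENNReal.ofReal_mul r.2.1] at h2
  · have h1' : (0 : ℝ) ≤ 1 - r := sub_nonneg.2 r.2.2
    have hr := r.2.1
    have := transmitProb_nonneg q
    exact (ENNReal.ofReal_eq_ofReal_iff (by positivity) (by positivity)).1 h2
  · exact ENNReal.mul_ne_top (ENNReal.mul_ne_top ENNReal.ofReal_ne_top (PMF.apply_ne_top _ _))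
      ENNReal.ofReal_ne_top

/-- The idle state is given the value `W / 2`, the mean of a fresh draw. From counter `0` the next
mean is then `W / 2` whether or not packets remain, and idle slots contribute no drift. -/
theorem tsum_step_mul_counter :
    ∑' t, step W lam T σ r s t *
        ENNReal.ofReal (if t.packets = 0 then (W : ℝ) / 2 else (t.counter : ℕ))
      + ENNReal.ofReal (1 - r) * (if s.counter ≠ 0 then 1 else 0)
      = ENNReal.ofReal (if s.packets = 0 then (W : ℝ) / 2 else (s.counter : ℕ))
        + ENNReal.ofReal ((W : ℝ) / 2) * (if s.counter = 0 ∧ s.packets ≠ 0 then 1 else 0) := by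
  by_cases hc : s.counter = 0
  · have h : ∀ n, ∑' t, drawBackoff W n t *
        ENNReal.ofReal (if t.packets = 0 then (W : ℝ) / 2 else (t.counter : ℕ))
        = ENNReal.ofReal ((W : ℝ) / 2) := by
      intro n
      rcases eq_or_ne n 0 with rfl | hn
      · exact tsum_drawBackoff_mul_of_const W 0 (fun k => by simp [State.packets_of])
      · rw [tsum_drawBackoff_mul]
        have := tsum_uniform_mul_ofReal W le_rfl zero_le_one
        simpa [State.packets_of, State.counter_of, hn] using this
    rw [tsum_step_mul_of_counter_eq_zero hc]
    simp_rw [h, ENNReal.tsum_mul_right, PMF.tsum_coe, one_mul, ← add_mul,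
      ofReal_add_ofReal_one_sub]
    by_cases hp : s.packets = 0 <;> simp [hc, hp]
  · have hp := State.packets_ne_zero hc
    have hk : (1 : ℝ) ≤ (s.counter : ℕ) := by
      exact_mod_cast Nat.one_le_iff_ne_zero.2 (fun h => hc (Fin.ext h))
    have hco : ∀ (k : Fin (W + 1)) a, (State.of k (s.packets + a)).counter = k :=
      fun k a => State.counter_of k (by omega)
    rw [tsum_step_mul_of_counter_ne_zero hc]
    simp only [State.packets_of, Nat.add_eq_zero_iff, hp, false_and, if_false,
      hco, ENNReal.tsum_mul_right, PMF.tsum_coe,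
      one_mul, natCast_counter_sub_one hc, hc, ne_eq, not_false_eq_true, if_true, mul_zero,
      add_zero]
    rw [add_assoc, ← mul_add, ← ENNReal.ofReal_one, ← ENNReal.ofReal_add (by linarith) zero_le_one,
      sub_add_cancel, ← add_mul, ofReal_add_ofReal_one_sub, one_mul]

/-- Balance of the back-off counter. -/
theorem counter_balance (hq : Stationary (step W lam T σ r) q) :
    (1 - r) * (1 - (q (State.of 0 0)).toReal - transmitProb q) = W / 2 * transmitProb q := by
  classical
  have h1 := hq.tsum_mul_eq_of_drift
    (F := fun s => ENNReal.ofReal (if s.packets = 0 then (W : ℝ) / 2 else (s.counter : ℕ)))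
    (g := fun s => ENNReal.ofReal (1 - r) * (if s.counter ≠ 0 then 1 else 0))
    (h := fun s => ENNReal.ofReal ((W : ℝ) / 2) *
      (if s.counter = 0 ∧ s.packets ≠ 0 then 1 else 0)) ?_ (fun s => tsum_step_mul_counter)
  · have h2 : q (State.of 0 0) + ENNReal.ofReal (transmitProb q)
        + ∑' s, q s * (if s.counter ≠ 0 then 1 else 0) = 1 := by
      have h3 : q (State.of 0 0) = ∑' s, q s * (if s = State.of 0 0 then 1 else 0) := by
        simp
      rw [ofReal_transmitProb, transmitProb_eq, h3, ← ENNReal.tsum_add, ← ENNReal.tsum_add]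
      conv_rhs => rw [← q.tsum_coe]
      refine tsum_congr fun s => ?_
      rw [← mul_add, ← mul_add]
      by_cases hp : s.packets = 0
      · simp [State.eq_of_zero_zero_iff, hp, s.counter_eq_zero hp]
      · by_cases hc : s.counter = 0 <;> simp [State.eq_of_zero_zero_iff, hp, hc]
    simp_rw [mul_left_comm (q _)] at h1
    rw [ENNReal.tsum_mul_left, ENNReal.tsum_mul_left, ← transmitProb_eq,
      ← ofReal_transmitProb] at h1
    set B := ∑' s, q s * (if s.counter ≠ 0 then (1 : ℝ≥0∞) else 0)
    have hB : B ≠ ⊤ := ne_top_of_le_ne_top ENNReal.one_ne_top (h2 ▸ le_add_self)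
    have h1' := congrArg ENNReal.toReal h1
    have h2' := congrArg ENNReal.toReal h2
    rw [ENNReal.toReal_mul, ENNReal.toReal_mul, ENNReal.toReal_ofReal (sub_nonneg.2 r.2.2),
      ENNReal.toReal_ofReal (by positivity), ENNReal.toReal_ofReal (transmitProb_nonneg q)] at h1'
    rw [ENNReal.toReal_add (by simp [PMF.apply_ne_top]) hB,
      ENNReal.toReal_add (PMF.apply_ne_top _ _) (by simp),
      ENNReal.toReal_ofReal (transmitProb_nonneg q), ENNReal.toReal_one] at h2'
    rw [← h1', ← h2']
    ring
  · refine ne_top_of_le_ne_top (b := ENNReal.ofReal W) ENNReal.ofReal_ne_top ?_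
    calc _ ≤ ∑' s, q s * ENNReal.ofReal W := by
          refine ENNReal.tsum_le_tsum fun s => ?_
          gcongr
          split_ifs
          · have : (0 : ℝ) ≤ W := by positivity
            linarith
          · exact_mod_cast Nat.lt_succ_iff.1 s.counter.2
      _ = _ := by rw [ENNReal.tsum_mul_right, PMF.tsum_coe, one_mul]

end step

/-! ### The equation for `u` -/

theorem fixedPoint_strictMono {W : ℕ} (M : ℕ) (hW : 1 ≤ W) {v w : ℝ} (hv : 0 ≤ v) (h : v < w) :
    2 * v ^ (M + 1) - W * (1 - v) < 2 * w ^ (M + 1) - W * (1 - w) := by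
  have hW' : (0 : ℝ) < W := by exact_mod_cast hW
  have h1 : v ^ (M + 1) < w ^ (M + 1) := pow_lt_pow_left₀ h hv (by omega)
  nlinarith

theorem exists_fixedPoint (M W : ℕ) (hW : 1 ≤ W) :
    ∃ u : ℝ, u ∈ Set.Ioo (0 : ℝ) 1 ∧ 2 * u ^ (M + 1) = W * (1 - u) := by
  have hW' : (0 : ℝ) < W := by exact_mod_cast hW
  have hc : ContinuousOn (fun u : ℝ => 2 * u ^ (M + 1) - W * (1 - u)) (Set.Icc 0 1) := by
    fun_prop
  obtain ⟨u, hu, h⟩ := intermediate_value_Ioo zero_le_one hc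
    (show (0 : ℝ) ∈ _ from ⟨by simpa using hW', by simp⟩)
  exact ⟨u, hu, by simpa [sub_eq_zero] using h⟩

theorem fixedPoint_unique {M W : ℕ} (hW : 1 ≤ W) {u v : ℝ} (hu0 : 0 ≤ u) (hv0 : 0 ≤ v)
    (hu : 2 * u ^ (M + 1) = W * (1 - u)) (hv : 2 * v ^ (M + 1) = W * (1 - v)) : v = u := by
  rcases lt_trichotomy v u with h | h | h
  · linarith [fixedPoint_strictMono M hW hv0 h]
  · exact h
  · linarith [fixedPoint_strictMono M hW hu0 h]

/-! ### The arrival rate as a function of the transmission probability -/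

/-- The arrival rate for which a station transmits with probability `1 - v`, when a slot is full
with probability `1 - v ^ M`. -/
noncomputable def rate (M : ℕ) (T σ v : ℝ) : ℝ :=
  (1 - v) * (1 - v ^ M) / ((1 - v ^ M) * T + v ^ M * σ)

section rate

variable {M W : ℕ} {T σ : ℝ}

theorem rate_denom_pos (hT : 0 < T) (hσ : 0 < σ) {v : ℝ} (hv : 0 < v) (hv1 : v ≤ 1) :
    0 < (1 - v ^ M) * T + v ^ M * σ := by
  have h0 : 0 < v ^ M := pow_pos hv M
  have h1 : 0 ≤ 1 - v ^ M := sub_nonneg.2 (pow_le_one₀ hv.le hv1)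
  positivity

/-- `rate` is the product of `1 - v` and a factor nonincreasing in `v ^ M`. After
cross-multiplication, `h1` compares the second factors and `h2` the first; strictness comes from
`h2`, since `w = 1` makes `h1` an equality. -/
theorem rate_strictAnti (hM : 1 ≤ M) (hT : 0 < T) (hσ : 0 < σ) {v w : ℝ} (hv : 0 < v)
    (h : v < w) (hw : w ≤ 1) : rate M T σ w < rate M T σ v := by
  have hp : v ^ M < w ^ M := pow_lt_pow_left₀ h hv.le (by omega)
  have hp0 : 0 < v ^ M := pow_pos hv M
  have hp1 : w ^ M ≤ 1 := pow_le_one₀ (hv.trans h).le hw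
  rw [rate, rate, div_lt_div_iff₀ (rate_denom_pos hT hσ (hv.trans h) hw)
    (rate_denom_pos hT hσ hv (h.le.trans hw))]
  set x := v ^ M
  set y := w ^ M
  have h1 : (1 - w) * ((1 - y) * ((1 - x) * T + x * σ))
      ≤ (1 - w) * ((1 - x) * ((1 - y) * T + y * σ)) := by
    refine mul_le_mul_of_nonneg_left ?_ (sub_nonneg.2 hw)
    nlinarith [mul_pos (sub_pos.2 hp) hσ]
  have h2 : (1 - w) * ((1 - x) * ((1 - y) * T + y * σ))
      < (1 - v) * ((1 - x) * ((1 - y) * T + y * σ)) := by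
    refine mul_lt_mul_of_pos_right (by linarith) (mul_pos (by linarith) ?_)
    have : 0 ≤ (1 - y) * T := mul_nonneg (by linarith) hT.le
    have : 0 < y * σ := mul_pos (by linarith) hσ
    linarith
  nlinarith

theorem exists_rate_eq (hT : 0 < T) (hσ : 0 < σ) {u lam : ℝ} (hu : 0 < u)
    (hu1 : u < 1) (hl : 0 < lam) (h : lam < rate M T σ u) :
    ∃ v ∈ Set.Ioo u 1, rate M T σ v = lam := by
  have hc : ContinuousOn (rate M T σ) (Set.Icc u 1) := by
    unfold rate
    refine ContinuousOn.div (by fun_prop) (by fun_prop) fun v hv => ?_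
    exact (rate_denom_pos hT hσ (hu.trans_le hv.1) hv.2).ne'
  obtain ⟨v, hv, h⟩ := intermediate_value_Ioo' hu1.le hc
    (show lam ∈ _ from ⟨by simpa [rate] using hl, h⟩)
  exact ⟨v, hv, h⟩

/-- Eliminating `W` shows that the denominator is positive and turns `lamMax` into a value of
`rate`. -/
theorem fixedPoint_denom {u : ℝ} (hu : 2 * u ^ (M + 1) = W * (1 - u)) :
    u * (2 + W) - W = 2 * u * (1 - u ^ M) := by
  rw [pow_succ] at hu
  linarith

theorem lamMax_eq_rate (hM : 1 ≤ M) (hT : 0 < T) (hσ : 0 < σ) {u : ℝ} (hu0 : 0 < u)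
    (hu1 : u < 1) (hu : 2 * u ^ (M + 1) = W * (1 - u)) : lamMax W T σ u = rate M T σ u := by
  have hp : 0 < 1 - u ^ M := sub_pos.2 (pow_lt_one₀ hu0.le hu1 (by omega))
  have hD := rate_denom_pos (M := M) hT hσ hu0 hu1.le
  have e : (W : ℝ) * σ * (1 - u) / (u * (2 + W) - W) = u ^ M * σ / (1 - u ^ M) := by
    rw [fixedPoint_denom hu, mul_right_comm, ← hu, div_eq_div_iff (by positivity) hp.ne']
    ring
  rw [lamMax, rate, e]
  have e2 : T + u ^ M * σ / (1 - u ^ M) = ((1 - u ^ M) * T + u ^ M * σ) / (1 - u ^ M) := by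
    field_simp
  rw [e2, div_div_eq_mul_div]

end rate

/-! ### Ergodicity of the network -/

theorem networkErgodic_iff {M W : ℕ} (hM : 1 ≤ M) (hW : 1 ≤ W) {lam T σ u : ℝ} (hl : 0 < lam)
    (hT : 0 < T) (hσ : 0 < σ) (hu0 : 0 < u) (hu1 : u < 1)
    (hu : 2 * u ^ (M + 1) = W * (1 - u)) :
    NetworkErgodic M W lam T σ ↔ lam < rate M T σ u := by
  have hW' : (0 : ℝ) < W := by exact_mod_cast hW
  constructor
  · rintro ⟨r, q, herg, hq, hr⟩
    have hdep := departure_rate hl hT hσ hq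
    have hbal := counter_balance hq
    have hidle : 0 < (q (State.of 0 0)).toReal :=
      ENNReal.toReal_pos (hq.pos herg.irreducible _).ne' (PMF.apply_ne_top _ _)
    have hτ0 := transmitProb_nonneg q
    set τ := transmitProb q
    set e := (q (State.of 0 0)).toReal
    have hr0 := r.2.1
    have hr1 : (0 : ℝ) ≤ 1 - r := sub_nonneg.2 r.2.2
    have hτ : 0 < τ := by
      refine lt_of_le_of_ne hτ0 fun h => ?_
      rw [← h] at hdep
      have : 0 < r * T + (1 - r) * σ := by
        rcases hr0.eq_or_lt with h' | h'
        · rw [← h']; simpa using hσ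
        · positivity
      have := mul_pos hl this
      linarith
    -- If every slot were full, counters would never decrease, and the counter balance would force
    -- `τ = 0`.
    have hr1' : 0 < 1 - (r : ℝ) := by
      refine lt_of_le_of_ne hr1 fun h => ?_
      rw [← h, zero_mul] at hbal
      exact absurd hbal (by positivity)
    obtain ⟨v, hv⟩ : ∃ v, v = 1 - τ := ⟨_, rfl⟩
    have hτv : τ = 1 - v := by linarith
    have hrv : (r : ℝ) = 1 - v ^ M := by rw [hr, hv]
    have hv0 : 0 < v := by
      have h1 : 0 < 1 - e - τ := by
        by_contra h
        have : (1 - (r : ℝ)) * (1 - e - τ) ≤ 0 :=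
          mul_nonpos_of_nonneg_of_nonpos hr1 (not_lt.1 h)
        have : 0 < W / 2 * τ := by positivity
        linarith
      linarith
    have hv1 : v ≤ 1 := by linarith
    -- The counter balance reads `v ^ M * (v - e) = W / 2 * (1 - v)`; dropping `e > 0` makes it
    -- strict.
    have hlt : W * (1 - v) < 2 * v ^ (M + 1) := by
      have h2 : (1 - (r : ℝ)) * e > 0 := mul_pos hr1' hidle
      rw [hrv, hτv] at hbal
      rw [hrv] at h2
      rw [pow_succ]
      linarith
    have huv : u < v := by
      by_contra h
      rcases (not_lt.1 h).eq_or_lt with h | h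
      · rw [h] at hlt; linarith
      · linarith [fixedPoint_strictMono M hW hv0.le h]
    have hlam : lam = rate M T σ v := by
      rw [rate, eq_div_iff (rate_denom_pos hT hσ hv0 hv1).ne']
      rw [hrv, hτv] at hdep
      linear_combination -hdep
    rw [hlam]
    exact rate_strictAnti hM hT hσ hu0 huv hv1
  · intro h
    obtain ⟨v, ⟨huv, hv1⟩, hv⟩ := exists_rate_eq hT hσ hu0 hu1 hl h
    have hv0 := hu0.trans huv
    have hp0 : 0 < v ^ M := pow_pos hv0 M
    have hp1 : v ^ M < 1 := pow_lt_one₀ hv0.le hv1 (by omega)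
    obtain ⟨r, hrv⟩ : ∃ r : unitInterval, (r : ℝ) = 1 - v ^ M :=
      ⟨⟨1 - v ^ M, by linarith, by linarith⟩, rfl⟩
    have hr0 : 0 < (r : ℝ) := by linarith
    have hr1 : (r : ℝ) < 1 := by linarith
    rw [rate, div_eq_iff (rate_denom_pos hT hσ hv0 hv1.le).ne'] at hv
    have hA : lam * (r * T + (1 - r) * σ) = r * (1 - v) := by
      rw [hrv]
      linear_combination -hv
    -- After division by `r`, this is `W (1 - v) < 2 v ^ (M + 1)`, hence `u < v`.
    have hstab : lam * (r * T + (1 - r) * σ) * (2 * (1 - r) + W) < r * (2 * (1 - r)) := by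
      rw [hA, mul_assoc]
      refine mul_lt_mul_of_pos_left ?_ hr0
      have := fixedPoint_strictMono M hW hu0.le huv
      rw [hu, sub_self, pow_succ] at this
      rw [hrv]
      linarith
    obtain ⟨q, hq⟩ := exists_stationary_step hl hT hσ hr0 hr1 hstab
    have hirr := irreducible_step (W := W) hl hT hσ hr0 hr1
    refine ⟨r, q, ⟨hirr, aperiodic_step hl hT hσ hr0 hr1, hq.positiveRecurrent (hq.pos hirr)⟩,
      hq, ?_⟩
    -- Consistency of `r`: packet conservation gives `r τ = r (1 - v)` with `r > 0`, so `τ = 1 - v`.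
    have hdep := departure_rate hl hT hσ hq
    rw [hA] at hdep
    rw [mul_left_cancel₀ hr0.ne' hdep, sub_sub_cancel, hrv]

end FairLoad

/-! ### The threshold and the maximum throughput -/

theorem mainTheorem4 (M W : ℕ) (hM : 1 ≤ M) (hW : 1 ≤ W) :
    ∃ u : ℝ, (u ∈ Set.Icc (0 : ℝ) 1 ∧ 2 * u ^ (M + 1) = W * (1 - u)) ∧
      (∀ v ∈ Set.Icc (0 : ℝ) 1, 2 * v ^ (M + 1) = W * (1 - v) → v = u) ∧
      0 < u * (2 + W) - W ∧
      ∀ T σ : ℝ, 0 < T → 0 < σ →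
        (∀ lam : ℝ, 0 < lam →
          (FairLoad.NetworkErgodic M W lam T σ ↔ lam < FairLoad.lamMax W T σ u)) ∧
        IsLUB {lam : ℝ | 0 < lam ∧ FairLoad.NetworkErgodic M W lam T σ}
          (FairLoad.lamMax W T σ u) := by
  obtain ⟨u, ⟨hu0, hu1⟩, hu⟩ := FairLoad.exists_fixedPoint M W hW
  have hp : u ^ M < 1 := pow_lt_one₀ hu0.le hu1 (by omega)
  refine ⟨u, ⟨⟨hu0.le, hu1.le⟩, hu⟩, fun v hv h => FairLoad.fixedPoint_unique hW hu0.le hv.1 hu h,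
    ?_, fun T σ hT hσ => ?_⟩
  · rw [FairLoad.fixedPoint_denom hu]
    have := sub_pos.2 hp
    positivity
  · have hiff : ∀ lam : ℝ, 0 < lam →
        (FairLoad.NetworkErgodic M W lam T σ ↔ lam < FairLoad.lamMax W T σ u) := by
      intro lam hl
      rw [FairLoad.lamMax_eq_rate hM hT hσ hu0 hu1 hu]
      exact FairLoad.networkErgodic_iff hM hW hl hT hσ hu0 hu1 hu
    have hpos : 0 < FairLoad.lamMax W T σ u := by
      rw [FairLoad.lamMax_eq_rate hM hT hσ hu0 hu1 hu, FairLoad.rate]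
      exact div_pos (mul_pos (sub_pos.2 hu1) (sub_pos.2 hp))
        (FairLoad.rate_denom_pos hT hσ hu0 hu1.le)
    refine ⟨hiff, ?_⟩
    have hset : {lam : ℝ | 0 < lam ∧ FairLoad.NetworkErgodic M W lam T σ}
        = Set.Ioo 0 (FairLoad.lamMax W T σ u) := by
      ext lam
      exact and_congr_right fun hl => hiff lam hl
    rw [hset]
    exact isLUB_Ioo hpos
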